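/- Let $V$ be a free $\mathbb{Z}$-module of finite rank $r$ with an alternating bilinear form $\langle\cdot,\cdot\rangle\colon V\times V\to\mathbb{Z}$ (possibly degenerate). For $v\in V$ let $T_v$ be the automorphism $T_v(x)=x-\langle x,v\rangle v$ of $V$, and for a subset $\Delta\subseteq V$ let $\Gamma_\Delta$ be the group generated by all $T_\delta$ with $\delta\in\Delta$. Call $\Delta$ a (skew-symmetric) vanishing lattice in $V$ if (i) $\Delta$ generates $V$; (ii) $\Delta$ is a single orbit under the action of $\Gamma_\Delta$; (iii) there are $\delta_1,\delta_2\in\Delta$ with $\langle\delta_1,\delta_2\rangle=1$; in that case $\Gamma_\Delta$ is called its monodromy group. Lemma. Let $\Delta\subseteq V$ be a vanishing lattice. Then there are $r$ linearly independent elements $\delta_1,\dots,\delta_r\in\Delta$ such that the subgroup $\Gamma_{\{\delta_1,\dots,\delta_r\}}$, generated by $T_{\delta_1},\dots,T_{\delta_r}$, has finite index in $\Gamma_\Delta$. -/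

import Mathlib

namespace VanishingLattice

variable {V : Type*} [AddCommGroup V] {B : LinearMap.BilinForm ℤ V}

/-- The symplectic transvection `x ↦ x - B(x, v) v` of an alternating form `B`, as an
automorphism of the `ℤ`-module `V`. -/
def symplecticTransvection (hB : B.IsAlt) (v : V) : V ≃ₗ[ℤ] V :=
  LinearEquiv.transvection (f := -B.flip v) (v := v) (by simp [hB.self_eq_zero v])

theorem symplecticTransvection_apply (hB : B.IsAlt) (v x : V) :
    symplecticTransvection hB v x = x - B x v • v := by
  simp [symplecticTransvection, LinearMap.transvection.apply, sub_eq_add_neg]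

/-- The group `Γ_Δ` generated by the transvections `T_δ` with `δ ∈ Δ`. As these preserve `B`,
and act trivially on the cokernel of `V → Hom(V, ℤ)`, it does not matter whether the subgroup
is generated inside `GL(V)`, inside `Sp(V)` or inside `Sp^#(V)`. -/
def transvectionGroup (hB : B.IsAlt) (Δ : Set V) : Subgroup (V ≃ₗ[ℤ] V) :=
  Subgroup.closure (symplecticTransvection hB '' Δ)

/-- A skew-symmetric vanishing lattice in `(V, B)`. -/
structure IsVanishingLattice (hB : B.IsAlt) (Δ : Set V) : Prop where
  /-- `Δ` generates `V`. -/
  span_eq_top : Submodule.span ℤ Δ = ⊤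
  /-- `Δ` is a single orbit of `Γ_Δ`. -/
  single_orbit : ∃ δ : V, Δ = MulAction.orbit (transvectionGroup hB Δ) δ
  /-- Some pair of elements of `Δ` has pairing `1`. -/
  exists_pair : ∃ δ₁ ∈ Δ, ∃ δ₂ ∈ Δ, B δ₁ δ₂ = 1

end VanishingLattice

/-! Call `v` a root of a group `Γ` if `T_v ∈ Γ`. Fix `d₁, d₂ ∈ Δ` with pairing `1`, so that `V = ℤd₁
⊕ ℤd₂ ⊕ K` with `K` the orthogonal complement of the pair. Eichler elements `T_{h+w} T_{h-w}⁻¹` act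
almost as translations along `w`. They yield `n ≠ 0` with `d₁ + n • K ⊆ Δ`
(`IsVanishingLattice.exists_add_smul_mem`). For a basis `b i` of `K`, the chosen vectors are `d₁`,
`d₂` and `d₁ + 2n • b i`. Let `Γ` be the group they generate, `U = 2nK` and `L = ℤd₁ + ℤd₂ + U`.

The factor `2` makes the form even on `U`. This forces every `d₁ + u` with `u ∈ U`
(`symplecticTransvection_add_mem`), and then every vector of `L` with pairing `1` against some
vector of `L` (`symplecticTransvection_mem_of_unimodular`), to be a root of `Γ`. Isometries
preserving `L` permute such vectors, hence normalise `Γ`.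

It remains to compare `Γ` with the isometries that preserve `L` and fix the radical. Fix more and
more vectors pointwise: at each stage `Γ` has finitely many orbits on the orbit of the next vector
(`relIndex_ne_zero_of_sup_span`), until the pointwise stabiliser is trivial
(`relIndex_latticeGroup_ne_zero`). Finally, a congruence argument modulo `2n` shows that the part of
`Γ_Δ` preserving `L` has finite index in `Γ_Δ` (`latticeGroup_relIndex_ne_zero`). -/

namespace VanishingLattice

/-! ### Transvections, Eichler elements and isometries. -/

section Transvections

variable {V : Type*} [AddCommGroup V] {B : LinearMap.BilinForm ℤ V}

local notation "τ" => symplecticTransvection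

theorem form_self (hB : B.IsAlt) (x : V) : B x x = 0 := hB x

theorem form_swap (hB : B.IsAlt) (x y : V) : B x y = -B y x := by
  have h := hB (x + y)
  simp only [map_add, LinearMap.add_apply] at h
  rw [form_self hB, form_self hB] at h
  linarith

variable (hB : B.IsAlt)

theorem symplecticTransvection_zpow_apply (v x : V) (j : ℤ) :
    (τ hB v ^ j) x = x - (j * B x v) • v := by
  induction j using Int.induction_on generalizing x with
  | zero => simp
  | succ n ih =>
    rw [zpow_add_one, LinearEquiv.mul_apply, ih, symplecticTransvection_apply]
    simp only [map_sub, map_smul, LinearMap.sub_apply, LinearMap.smul_apply, form_self hB]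
    module
  | pred n ih =>
    have h : (τ hB v) (x + B x v • v) = x := by
      rw [symplecticTransvection_apply]
      simp [form_self hB]
    have h' : (τ hB v)⁻¹ x = x + B x v • v := by
      exact ((τ hB v).symm_apply_eq).2 h.symm
    rw [zpow_sub_one, LinearEquiv.mul_apply, h', ih]
    simp only [map_add, map_smul, LinearMap.add_apply, LinearMap.smul_apply, form_self hB]
    module

theorem symplecticTransvection_inv_apply (v x : V) :
    (τ hB v)⁻¹ x = x + B x v • v := by
  have := symplecticTransvection_zpow_apply hB v x (-1)
  rw [zpow_neg_one] at this
  rw [this]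
  module

theorem symplecticTransvection_neg (v : V) : τ hB (-v) = τ hB v := by
  ext x
  simp [symplecticTransvection_apply]

/-- The quadratic terms of the two transvections cancel. For `h` in the hyperbolic plane and `w`
orthogonal to it, this translates `x` along `w` by an amount depending only on `B x h`, up to a
multiple of `h`. -/
theorem eichler_apply {h w : V} (hw : B h w = 0) (x : V) :
    (τ hB (h + w) * (τ hB (h - w))⁻¹) x = x - (2 * B x h) • w - (2 * B x w) • h := by
  have hw' : B w h = 0 := by rw [form_swap hB, hw, neg_zero]
  rw [LinearEquiv.mul_apply, symplecticTransvection_inv_apply, symplecticTransvection_apply]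
  simp only [map_add, map_sub, map_smul, LinearMap.add_apply, LinearMap.sub_apply,
    LinearMap.smul_apply, form_self hB, hw, hw']
  module

variable (B) in
/-- The isometries of `B`. -/
def isometryGroup : Subgroup (V ≃ₗ[ℤ] V) where
  carrier := {g | ∀ x y, B (g x) (g y) = B x y}
  mul_mem' := fun {a b} ha hb x y => (ha (b x) (b y)).trans (hb x y)
  one_mem' := fun _ _ => rfl
  inv_mem' := fun {a} ha x y => by
    have := ha (a⁻¹ x) (a⁻¹ y)
    rw [← LinearEquiv.mul_apply, ← LinearEquiv.mul_apply, mul_inv_cancel] at this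
    exact this.symm

theorem symplecticTransvection_mem_isometryGroup (v : V) : τ hB v ∈ isometryGroup B := by
  intro x y
  simp only [symplecticTransvection_apply, map_sub, map_smul, LinearMap.sub_apply,
    LinearMap.smul_apply, form_self hB, smul_eq_mul]
  rw [form_swap hB v y]
  ring

theorem conj_symplecticTransvection {g : V ≃ₗ[ℤ] V} (hg : g ∈ isometryGroup B) (v : V) :
    g * τ hB v * g⁻¹ = τ hB (g v) := by
  ext x
  obtain ⟨y, rfl⟩ := g.surjective x
  have : g⁻¹ (g y) = y := g.symm_apply_apply y
  rw [LinearEquiv.mul_apply, LinearEquiv.mul_apply, this, symplecticTransvection_apply,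
    symplecticTransvection_apply, map_sub, map_smul, hg]

theorem transvectionGroup_le_isometryGroup (S : Set V) :
    transvectionGroup hB S ≤ isometryGroup B := by
  rw [transvectionGroup, Subgroup.closure_le]
  rintro _ ⟨v, -, rfl⟩
  exact symplecticTransvection_mem_isometryGroup hB v

theorem symplecticTransvection_mem_of_mem {S : Set V} {v : V} (hv : v ∈ S) :
    τ hB v ∈ transvectionGroup hB S :=
  Subgroup.subset_closure ⟨v, hv, rfl⟩

end Transvections

/-! ### Euclidean reduction by a hyperbolic pair. -/

section HyperbolicPair

variable {V : Type*} [AddCommGroup V] {B : LinearMap.BilinForm ℤ V} (hB : B.IsAlt)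
  {d₁ d₂ : V}

local notation "τ" => symplecticTransvection

/-- The quarter turn `d₁ ↦ -d₂`, `d₂ ↦ d₁` of a hyperbolic plane, as a product of
transvections. -/
def quarterTurn (d₁ d₂ : V) : V ≃ₗ[ℤ] V := τ hB d₁ * τ hB d₂ * τ hB d₁

theorem quarterTurn_mem {Q : Subgroup (V ≃ₗ[ℤ] V)} (h₁ : τ hB d₁ ∈ Q) (h₂ : τ hB d₂ ∈ Q) :
    quarterTurn hB d₁ d₂ ∈ Q :=
  Q.mul_mem (Q.mul_mem h₁ h₂) h₁

theorem quarterTurn_apply (hd : B d₁ d₂ = 1) (x : V) :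
    quarterTurn hB d₁ d₂ x = x - (B x d₂ - B d₁ x) • d₁ - (B x d₂ + B d₁ x) • d₂ := by
  have hd' : B d₂ d₁ = -1 := by rw [form_swap hB, hd]
  simp only [quarterTurn, LinearEquiv.mul_apply, symplecticTransvection_apply, map_sub, map_smul,
    form_self hB, hd, hd']
  rw [form_swap hB d₁ x]
  module

/-- Reduction of a vector to one whose component in a hyperbolic plane is a multiple of the
first basis vector, with a divisibility property. -/
theorem exists_reduced (hd : B d₁ d₂ = 1) {Q : Subgroup (V ≃ₗ[ℤ] V)} (h₁ : τ hB d₁ ∈ Q) (h₂ : τ hB d₂ ∈ Q)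
    {M : Submodule ℤ V} (hM₁ : ∀ w ∈ M, B d₁ w = 0) (hM₂ : ∀ w ∈ M, B d₂ w = 0)
    (hM : ∀ w ∈ M, τ hB (d₂ + w) ∈ Q) (v : V)
    (hv : B v d₂ ≠ 0 ∨ B d₁ v ≠ 0 ∨ ∃ w ∈ M, B v w ≠ 0) :
    ∃ k ∈ Q, B (k v) d₂ ≠ 0 ∧ B d₁ (k v) = 0 ∧ ∀ w ∈ M, B (k v) d₂ ∣ 2 * B (k v) w := by
  have hd' : B d₂ d₁ = -1 := by rw [form_swap hB, hd]
  have hturn : ∀ x, B (quarterTurn hB d₁ d₂ x) d₂ = B d₁ x := by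
    intro x
    rw [quarterTurn_apply hB hd]
    simp only [map_sub, map_smul, LinearMap.sub_apply, LinearMap.smul_apply, form_self hB, hd,
      smul_eq_mul]
    ring
  have hQt : quarterTurn hB d₁ d₂ ∈ Q := quarterTurn_mem hB h₁ h₂
  have hE : ∀ w ∈ M, τ hB (d₂ + w) * (τ hB (d₂ - w))⁻¹ ∈ Q := fun w hw =>
    Q.mul_mem (hM w hw) (Q.inv_mem (by simpa [sub_eq_add_neg] using hM (-w) (M.neg_mem hw)))
  have key : ∃ n : ℕ, ∃ k ∈ Q, B (k v) d₂ ≠ 0 ∧ (B (k v) d₂).natAbs = n := by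
    have turn : (∃ k ∈ Q, B d₁ (k v) ≠ 0) → ∃ n : ℕ, ∃ k ∈ Q, B (k v) d₂ ≠ 0 ∧
        (B (k v) d₂).natAbs = n := by
      rintro ⟨k, hk, h⟩
      exact ⟨_, quarterTurn hB d₁ d₂ * k, Q.mul_mem hQt hk,
        by rw [LinearEquiv.mul_apply, hturn]; exact h, rfl⟩
    by_cases ha : B v d₂ = 0
    · refine turn ?_
      by_cases hb : B d₁ v = 0
      · obtain h | h | ⟨w, hw, h⟩ := hv
        · exact absurd ha h
        · exact absurd hb h
        -- When `v` is orthogonal to the pair, the Eichler element adds a multiple of `d₂` with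
        -- coefficient `-2 * B v w ≠ 0`.
        · refine ⟨_, hE w hw, ?_⟩
          rw [eichler_apply hB (hM₂ w hw)]
          simp [ha, hb, hd, h]
      · exact ⟨1, Q.one_mem, hb⟩
    · exact ⟨_, 1, Q.one_mem, ha, rfl⟩
  -- Choose `k` with the least nonzero `|B (k v) d₂|`; both divisibility claims come from this
  -- minimality.
  classical
  obtain ⟨k, hk, hk0, hkn⟩ := Nat.find_spec key
  have hmin : ∀ g ∈ Q, B (g v) d₂ ≠ 0 → (B (k v) d₂).natAbs ≤ (B (g v) d₂).natAbs := by
    intro g hg hg0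
    rw [hkn]
    exact Nat.find_min' key ⟨g, hg, hg0, rfl⟩
  -- One Euclidean step: a power of `T_{d₂}` followed by the quarter turn turns the `d₂`-pairing
  -- into the remainder `b % a`, which would be smaller.
  have hstep : ∀ g ∈ Q, B (g v) d₂ = B (k v) d₂ → B (k v) d₂ ∣ B d₁ (g v) := by
    intro g hg hgk
    set a := B (k v) d₂ with ha
    set b := B d₁ (g v) with hb
    by_contra hab
    have hr : b % a ≠ 0 := fun h => hab (Int.dvd_of_emod_eq_zero h)
    have hval : B ((quarterTurn hB d₁ d₂ * τ hB d₂ ^ (b / a) * g) v) d₂ = b % a := by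
      rw [LinearEquiv.mul_apply, LinearEquiv.mul_apply, hturn,
        symplecticTransvection_zpow_apply, map_sub, map_smul, hd, hgk, Int.emod_def]
      simp only [smul_eq_mul]
      ring
    have := hmin _ (Q.mul_mem (Q.mul_mem hQt (Q.zpow_mem h₂ (b / a))) hg)
      (by rwa [hval])
    rw [hval] at this
    have hlt := Int.natAbs_lt_natAbs_of_nonneg_of_lt (Int.emod_nonneg b hk0) (Int.emod_lt_abs b hk0)
    rw [Int.natAbs_abs] at hlt
    exact absurd this (not_le.2 hlt)
  obtain ⟨q, hq⟩ := hstep k hk rfl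
  have hkv : ∀ y, B ((τ hB d₂ ^ q * k) v) y = B (k v) y - q * B (k v) d₂ * B d₂ y := by
    intro y
    simp [LinearEquiv.mul_apply, symplecticTransvection_zpow_apply]
  have hkv₁ : B d₁ ((τ hB d₂ ^ q * k) v) = 0 := by
    rw [form_swap hB, hkv, hd', form_swap hB (k v) d₁, hq]
    ring
  have hkv₂ : B ((τ hB d₂ ^ q * k) v) d₂ = B (k v) d₂ := by
    rw [hkv, form_self hB]
    ring
  have hk' := Q.mul_mem (Q.zpow_mem h₂ q) hk
  refine ⟨_, hk', by rwa [hkv₂], hkv₁, fun w hw => ?_⟩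
  -- The Eichler element along `w` keeps the `d₂`-pairing and changes the `d₁`-pairing from `0` to
  -- `-2 * B (k v) w`, so minimality applies again.
  have h := hstep _ (Q.mul_mem (hE w hw) hk') (by
    rw [LinearEquiv.mul_apply, eichler_apply hB (hM₂ w hw), ← hkv₂]
    have : B w d₂ = 0 := by rw [form_swap hB, hM₂ w hw, neg_zero]
    simp [this, form_self hB])
  rw [LinearEquiv.mul_apply, eichler_apply hB (hM₂ w hw), map_sub, map_sub, hkv₁, map_smul,
    map_smul, hM₁ w hw, hd] at h
  rw [hkv₂]
  simpa using h

end HyperbolicPair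

/-! ### Finite index criteria. -/

section FiniteIndex

variable {G : Type*} [Group G]

theorem relIndex_ne_zero_of_finite_image {H K : Subgroup G} {α : Type*} (φ : G → α)
    (hfin : (φ '' (K : Set G)).Finite)
    (h : ∀ g ∈ K, ∀ g' ∈ K, φ g = φ g' → g⁻¹ * g' ∈ H) : H.relIndex K ≠ 0 := by
  have := hfin.to_subtype
  have : Finite (K ⧸ H.subgroupOf K) := by
    refine Finite.of_injective
      (fun q : K ⧸ H.subgroupOf K => (⟨φ q.out, q.out, q.out.2, rfl⟩ : φ '' (K : Set G))) ?_
    intro q q' hq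
    rw [← q.out_eq', ← q'.out_eq', QuotientGroup.eq, Subgroup.mem_subgroupOf]
    exact h _ q.out.2 _ q'.out.2 (congrArg Subtype.val hq)
  exact Subgroup.index_ne_zero_of_finite

/-- If `Γ` is normalised by `Q`, meets the subgroup `S` of `Q` in finite index, and
`Γ \ Q / S` is finite, then `Γ` meets `Q` in finite index. -/
theorem relIndex_ne_zero_of_stabilizer {Γ Q S : Subgroup G}
    (hnorm : ∀ g ∈ Q, ∀ γ ∈ Γ, g * γ * g⁻¹ ∈ Γ) (hS : Γ.relIndex S ≠ 0)
    {α : Type*} (φ : G → α) (hfin : (φ '' (Q : Set G)).Finite)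
    (h : ∀ g ∈ Q, ∀ g' ∈ Q, φ g = φ g' → ∃ k ∈ Γ, g'⁻¹ * k * g ∈ S) : Γ.relIndex Q ≠ 0 := by
  have hr : ∀ c ∈ φ '' (Q : Set G), ∃ r ∈ Q, φ r = c := fun c hc => hc
  choose! r hrQ hr using hr
  have hk : ∀ g ∈ Q, ∃ k ∈ Γ, (r (φ g))⁻¹ * k * g ∈ S := fun g hg =>
    h g hg _ (hrQ _ ⟨g, hg, rfl⟩) (hr _ ⟨g, hg, rfl⟩).symm
  choose! k hkΓ hkS using hk
  have : (Γ.subgroupOf S).FiniteIndex := ⟨hS⟩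
  have : Finite (S ⧸ Γ.subgroupOf S) := inferInstance
  classical
  let s : G → S := fun g => if hg : g ∈ Q then ⟨_, hkS g hg⟩ else 1
  have hs : ∀ g ∈ Q, (s g : G) = (r (φ g))⁻¹ * k g * g := fun g hg => by simp [s, hg]
  -- Separate elements of `Q` by the value of `φ` and by the coset of the element of `S` obtained by
  -- moving `g` to the representative of its class. The factors from `Γ` left in `g⁻¹ * g'` are
  -- absorbed by normality.
  refine relIndex_ne_zero_of_finite_image
    (fun g => (φ g, (QuotientGroup.mk (s g) : S ⧸ Γ.subgroupOf S))) ?_ ?_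
  · refine (hfin.prod (Set.finite_univ (α := S ⧸ Γ.subgroupOf S))).subset ?_
    rintro _ ⟨g, hg, rfl⟩
    exact ⟨⟨g, hg, rfl⟩, trivial⟩
  · intro g hg g' hg' hgg
    obtain ⟨h₁, h₂⟩ := Prod.mk.inj hgg
    rw [QuotientGroup.eq, Subgroup.mem_subgroupOf] at h₂
    push_cast at h₂
    rw [hs g' hg', ← h₁] at h₂
    rw [hs g hg] at h₂
    have hx := hnorm _ (Q.inv_mem hg) _ (Γ.mul_mem (Γ.inv_mem (hkΓ g' hg')) (hkΓ g hg))
    convert Γ.mul_mem hx h₂ using 1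
    group

end FiniteIndex

theorem exists_finite_residue (V : Type*) [AddCommGroup V] [Module.Free ℤ V] [Module.Finite ℤ V] (C : ℤ) :
    ∃ (n : ℕ) (f : V → Fin n → ZMod C.natAbs),
      ∀ x y, f x = f y → ∃ z, x - y = C • z := by
  let b := Module.finBasis ℤ V
  refine ⟨_, fun x i => (b.repr x i : ZMod C.natAbs), fun x y hxy => ?_⟩
  have : ∀ i, ∃ c, b.repr x i - b.repr y i = C * c := fun i => by
    have h := (ZMod.intCast_eq_intCast_iff_dvd_sub _ _ _).1 (congrFun hxy i)
    rw [Int.natCast_natAbs, abs_dvd] at h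
    obtain ⟨c, hc⟩ := h
    exact ⟨-c, by linarith⟩
  choose c hc using this
  refine ⟨∑ i, c i • b i, b.ext_elem fun i => ?_⟩
  simp [hc, Finsupp.single_apply]

/-! ### Finitely many orbits: passing to the stabiliser of one more vector. -/

section LatticeGroup

variable {V : Type*} [AddCommGroup V] {B : LinearMap.BilinForm ℤ V}

local notation "τ" => symplecticTransvection

/-- `U` has finite exponent in the orthogonal complement of the hyperbolic pair `d₁, d₂`, and
`B` takes only even values on `U`. -/
structure IsEvenComplement (B : LinearMap.BilinForm ℤ V) (d₁ d₂ : V) (U : Submodule ℤ V)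
    (N : ℤ) : Prop where
  pair : B d₁ d₂ = 1
  left : ∀ u ∈ U, B d₁ u = 0
  right : ∀ u ∈ U, B d₂ u = 0
  even : ∀ u ∈ U, ∀ w ∈ U, 2 ∣ B u w
  ne_zero : N ≠ 0
  smul_mem : ∀ x, B d₁ x = 0 → B d₂ x = 0 → N • x ∈ U

/-- The lattice spanned by `d₁`, `d₂` and `U`. -/
def pairSpan (d₁ d₂ : V) (U : Submodule ℤ V) : Submodule ℤ V := Submodule.span ℤ {d₁, d₂} ⊔ U

theorem mem_pairSpan {d₁ d₂ : V} {U : Submodule ℤ V} {x : V} :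
    x ∈ pairSpan d₁ d₂ U ↔ ∃ a b : ℤ, ∃ u ∈ U, x = a • d₁ + b • d₂ + u := by
  rw [pairSpan, Submodule.mem_sup]
  constructor
  · rintro ⟨y, hy, u, hu, rfl⟩
    obtain ⟨a, b, rfl⟩ := Submodule.mem_span_pair.1 hy
    exact ⟨a, b, u, hu, rfl⟩
  · rintro ⟨a, b, u, hu, rfl⟩
    exact ⟨_, Submodule.mem_span_pair.2 ⟨a, b, rfl⟩, u, hu, rfl⟩

variable (B) in
/-- The isometries of `B` that preserve the lattice `L` and fix `P` pointwise. -/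
def latticeGroup (L P : Submodule ℤ V) : Subgroup (V ≃ₗ[ℤ] V) where
  carrier := {g | g ∈ isometryGroup B ∧ (∀ x, g x ∈ L ↔ x ∈ L) ∧ ∀ p ∈ P, g p = p}
  mul_mem' := fun {a b} ha hb => ⟨mul_mem ha.1 hb.1, fun x => (ha.2.1 (b x)).trans (hb.2.1 x),
    fun p hp => (congrArg a (hb.2.2 p hp)).trans (ha.2.2 p hp)⟩
  one_mem' := ⟨one_mem _, fun _ => Iff.rfl, fun _ _ => rfl⟩
  inv_mem' := fun {a} ha => ⟨inv_mem ha.1, fun x => by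
    rw [← ha.2.1, ← LinearEquiv.mul_apply, mul_inv_cancel, LinearEquiv.coe_one, id],
    fun p hp => by
    conv_lhs => rw [← ha.2.2 p hp]
    rw [← LinearEquiv.mul_apply, inv_mul_cancel, LinearEquiv.coe_one, id]⟩

theorem latticeGroup_anti (L : Submodule ℤ V) {P P' : Submodule ℤ V} (h : P ≤ P') :
    latticeGroup B L P' ≤ latticeGroup B L P :=
  fun _ hg => ⟨hg.1, hg.2.1, fun p hp => hg.2.2 p (h hp)⟩

theorem mem_latticeGroup_sup_span {L P : Submodule ℤ V} {g : V ≃ₗ[ℤ] V}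
    (hg : g ∈ latticeGroup B L P) {x : V} (hx : g x = x) :
    g ∈ latticeGroup B L (P ⊔ Submodule.span ℤ {x}) := by
  refine ⟨hg.1, hg.2.1, fun p hp => ?_⟩
  obtain ⟨q, hq, y, hy, rfl⟩ := Submodule.mem_sup.1 hp
  obtain ⟨c, rfl⟩ := Submodule.mem_span_singleton.1 hy
  rw [map_add, map_smul, hx, hg.2.2 q hq]

theorem symplecticTransvection_mem_latticeGroup (hB : B.IsAlt) {L P : Submodule ℤ V} {v : V}
    (hv : v ∈ L) (hP : ∀ p ∈ P, B p v = 0) : τ hB v ∈ latticeGroup B L P := by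
  refine ⟨symplecticTransvection_mem_isometryGroup hB v, fun x => ?_, fun p hp => ?_⟩
  · rw [symplecticTransvection_apply]
    exact Submodule.sub_mem_iff_left L (L.smul_mem _ hv)
  · rw [symplecticTransvection_apply, hP p hp, zero_smul, sub_zero]

theorem form_apply_of_mem_latticeGroup {L P : Submodule ℤ V} {g : V ≃ₗ[ℤ] V}
    (hg : g ∈ latticeGroup B L P) {p : V} (hp : p ∈ P) (x : V) : B p (g x) = B p x := by
  conv_lhs => rw [← hg.2.2 p hp]
  exact hg.1 p x

variable {d₁ d₂ : V} {U : Submodule ℤ V} {N : ℤ} {Γ : Subgroup (V ≃ₗ[ℤ] V)}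

local notation "L" => pairSpan d₁ d₂ U

theorem left_mem_pairSpan : d₁ ∈ L := mem_pairSpan.2 ⟨1, 0, 0, U.zero_mem, by simp⟩

theorem right_mem_pairSpan : d₂ ∈ L := mem_pairSpan.2 ⟨0, 1, 0, U.zero_mem, by simp⟩

theorem le_pairSpan : U ≤ L := le_sup_right

theorem sub_mem_of_mem_pairSpan (hB : B.IsAlt) (h : IsEvenComplement B d₁ d₂ U N) {x : V} (hx : x ∈ L) :
    x - B x d₂ • d₁ - B d₁ x • d₂ ∈ U := by
  obtain ⟨a, b, u, hu, rfl⟩ := mem_pairSpan.1 hx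
  have : B u d₂ = 0 := by rw [form_swap hB, h.right u hu, neg_zero]
  simp only [map_add, map_smul, LinearMap.add_apply, LinearMap.smul_apply, form_self hB, h.pair,
    this, h.left u hu]
  convert hu using 1
  simp only [smul_eq_mul]
  module

/-- If `Γ` has finite index in the stabiliser of `x` in a lattice group, then it has finite index
in the lattice group: it has finitely many orbits on the orbit of `x`. -/
theorem relIndex_ne_zero_of_sup_span [Module.Free ℤ V] [Module.Finite ℤ V] (hB : B.IsAlt)
    (h : IsEvenComplement B d₁ d₂ U N)
    (hΓ : ∀ v ∈ L, (∃ w ∈ L, B v w = 1) → τ hB v ∈ Γ)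
    (hn : ∀ g ∈ latticeGroup B L ⊥, ∀ γ ∈ Γ, g * γ * g⁻¹ ∈ Γ) {P : Submodule ℤ V}
    (hP₁ : ∀ p ∈ P, B p d₁ = 0) (hP₂ : ∀ p ∈ P, B p d₂ = 0) {x w : V} (hw : w ∈ L)
    (hwP : ∀ p ∈ P, B p w = 0) (hxw : B x w ≠ 0)
    (hs : Γ.relIndex (latticeGroup B L (P ⊔ Submodule.span ℤ {x})) ≠ 0) :
    Γ.relIndex (latticeGroup B L P) ≠ 0 := by
  set m := B x w with hm
  have hd' : B d₂ d₁ = -1 := by rw [form_swap hB, h.pair]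
  have hroot : ∀ v ∈ L, (∃ w ∈ L, B v w = 1) → (∀ p ∈ P, B p v = 0) →
      τ hB v ∈ Γ ⊓ latticeGroup B L P := fun v hv hv' hvP =>
    ⟨hΓ v hv hv', symplecticTransvection_mem_latticeGroup hB hv hvP⟩
  -- Directions `y` for which `T_{d₂ + y}` fixes `P`, so that reduction stays inside the stabiliser
  -- of `P`.
  let M : Submodule ℤ V := U ⊓ B.orthogonal P
  have hM : ∀ y ∈ M, τ hB (d₂ + y) ∈ Γ ⊓ latticeGroup B L P := fun y hy =>
    hroot _ (add_mem right_mem_pairSpan (le_pairSpan hy.1))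
      ⟨-d₁, neg_mem left_mem_pairSpan, by
        have : B y d₁ = 0 := by rw [form_swap hB, h.left y hy.1, neg_zero]
        simp [hd', this]⟩
      fun p hp => by rw [map_add, hP₂ p hp, show B p y = 0 from hy.2 p hp, add_zero]
  have h₁ := hroot d₁ left_mem_pairSpan ⟨d₂, right_mem_pairSpan, h.pair⟩ hP₁
  have h₂ : τ hB d₂ ∈ Γ ⊓ latticeGroup B L P := by simpa using hM 0 M.zero_mem
  have hred : ∀ g ∈ latticeGroup B L P, ∃ k ∈ Γ ⊓ latticeGroup B L P,
      B (k (g x)) d₂ ≠ 0 ∧ B d₁ (k (g x)) = 0 ∧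
        ∀ y ∈ M, B (k (g x)) d₂ ∣ 2 * B (k (g x)) y := by
    intro g hg
    refine exists_reduced hB h.pair h₁ h₂ (M := M) (fun y hy => h.left y hy.1)
      (fun y hy => h.right y hy.1) hM (g x) ?_
    by_contra! hcon
    obtain ⟨hc₁, hc₂, hc⟩ := hcon
    refine hxw ?_
    have hgw := sub_mem_of_mem_pairSpan hB h ((hg.2.1 w).2 hw)
    have := hc _ ⟨hgw, fun p hp => ?_⟩
    · rw [map_sub, map_sub, map_smul, map_smul, hc₁, form_swap hB (g x) d₁, hc₂, hg.1] at this
      simpa using this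
    · change B p _ = 0
      rw [map_sub, map_sub, map_smul, map_smul, hP₁ p hp, hP₂ p hp,
        form_apply_of_mem_latticeGroup hg hp, hwP p hp]
      simp
  choose! k hk hk0 hk1 hkd using hred
  -- Isometries carry `m = B x w` along. The component of the image of `w` in `U` lies in `M`, so
  -- the divisibility on `M` bounds the `d₁`-coefficient independently of `g`.
  have hkL : ∀ g ∈ latticeGroup B L P, B (k g (g x)) d₂ ∣ 2 * m := by
    intro g hg
    have hkg := mul_mem (hk g hg).2 hg
    have hkw := sub_mem_of_mem_pairSpan hB h ((hkg.2.1 w).2 hw)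
    have hkwP : ∀ p ∈ P, B p ((k g * g) w) = 0 := fun p hp => by
      rw [form_apply_of_mem_latticeGroup hkg hp, hwP p hp]
    have := hkd g hg _ ⟨hkw, fun p hp => by
      change B p _ = 0
      rw [map_sub, map_sub, map_smul, map_smul, hP₁ p hp, hP₂ p hp, hkwP p hp]
      simp⟩
    rw [map_sub, map_sub, map_smul, map_smul, ← LinearEquiv.mul_apply, hkg.1, ← hm,
      LinearEquiv.mul_apply, form_swap hB _ d₁, hk1 g hg, neg_zero, smul_zero, sub_zero, mul_sub,
      smul_eq_mul] at this
    exact (dvd_sub_left (Dvd.intro_left (2 * B d₁ ((k g * g) w)) (by ring))).1 this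
  -- With `a * c = 2 * m` one has `4 * m * N = 2 * a * (c * N)`: the factor `N` brings `z` into `U`,
  -- and `2 * a` is the step by which an Eichler element translates.
  obtain ⟨n, f, hf⟩ := exists_finite_residue V (4 * m * N)
  have hC : 4 * m * N ≠ 0 := mul_ne_zero (mul_ne_zero four_ne_zero hxw) h.ne_zero
  have : NeZero (4 * m * N).natAbs := ⟨Int.natAbs_ne_zero.2 hC⟩
  refine relIndex_ne_zero_of_stabilizer
    (fun g hg => hn g (latticeGroup_anti _ bot_le hg)) hs
    (fun g => (B (k g (g x)) d₂, f (k g (g x)))) ?_ ?_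
  · refine ((Set.finite_Icc (-|2 * m|) |2 * m|).prod
      (Set.finite_univ (α := Fin n → ZMod (4 * m * N).natAbs))).subset ?_
    rintro _ ⟨g, hg, rfl⟩
    refine ⟨abs_le.1 ?_, trivial⟩
    exact Int.le_of_dvd (abs_pos.2 (mul_ne_zero two_ne_zero hxw))
      ((abs_dvd_abs _ _).2 (hkL g hg))
  · intro g hg g' hg' hgg
    obtain ⟨ha, hres⟩ := Prod.mk.inj hgg
    obtain ⟨z, hz⟩ := hf _ _ hres
    set v := k g (g x) with hv
    set v' := k g' (g' x) with hv'
    set a := B v d₂ with hadef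
    obtain ⟨c, hc⟩ : a ∣ 2 * m := hkL g hg
    have hzt : ∀ y, B y v = B y v' → B y z = 0 := fun y hy => by
      have := congrArg (B y) hz
      rw [map_sub, hy, sub_self, map_smul, smul_eq_mul] at this
      exact (mul_eq_zero.1 this.symm).resolve_left hC
    have hz₁ : B d₁ z = 0 := hzt _ ((hk1 g hg).trans (hk1 g' hg').symm)
    have hz₂ : B d₂ z = 0 := hzt _ (by rw [form_swap hB, form_swap hB d₂, ← ha])
    have hyM : c • N • z ∈ M := by
      refine ⟨U.smul_mem _ (h.smul_mem z hz₁ hz₂), fun p hp => ?_⟩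
      change B p _ = 0
      rw [map_smul, map_smul, hzt p, smul_zero, smul_zero]
      rw [hv, hv', form_apply_of_mem_latticeGroup (hk g hg).2 hp,
        form_apply_of_mem_latticeGroup hg hp, form_apply_of_mem_latticeGroup (hk g' hg').2 hp,
        form_apply_of_mem_latticeGroup hg' hp]
    set y := c • N • z with hy
    have hvy : v - v' = (2 * a) • y := by
      rw [hz, hy, smul_smul, smul_smul]
      congr 1
      linear_combination (2 * N) * hc
    obtain ⟨q, hq⟩ := hkd g hg y hyM
    set E := τ hB (d₂ + y) * (τ hB (d₂ - y))⁻¹ with hE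
    have hEmem : E ∈ Γ ⊓ latticeGroup B L P :=
      mul_mem (hM y hyM) (inv_mem (by simpa [sub_eq_add_neg] using hM (-y) (M.neg_mem hyM)))
    -- `E` moves `v` by `-(2 * a) • y` and by `-(2 * B v y) • d₂`. As `a` divides `2 * B v y`, a
    -- power of `T_{d₂}` removes the second term.
    have hK : (τ hB d₂ ^ (-q) * E) v = v' := by
      rw [LinearEquiv.mul_apply, hE, eichler_apply hB (h.right y hyM.1),
        symplecticTransvection_zpow_apply]
      have : B y d₂ = 0 := by rw [form_swap hB, h.right y hyM.1, neg_zero]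
      simp only [map_sub, map_smul, LinearMap.sub_apply, LinearMap.smul_apply, this,
        form_self hB, ← hadef]
      rw [show v' = v - (2 * a) • y by rw [← hvy]; abel, hq]
      simp only [smul_eq_mul]
      module
    have hKmem : (k g')⁻¹ * (τ hB d₂ ^ (-q) * E) * k g ∈ Γ ⊓ latticeGroup B L P :=
      mul_mem (mul_mem (inv_mem (hk g' hg')) (mul_mem (zpow_mem h₂ _) hEmem)) (hk g hg)
    refine ⟨_, hKmem.1, mem_latticeGroup_sup_span
      (mul_mem (mul_mem (inv_mem hg') hKmem.2) hg) ?_⟩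
    have : (g'⁻¹ * ((k g')⁻¹ * (τ hB d₂ ^ (-q) * E) * k g) * g) x =
        (k g' * g')⁻¹ ((τ hB d₂ ^ (-q) * E) v) := by
      rw [mul_inv_rev]
      rfl
    rw [this, hK]
    exact (k g' * g').symm_apply_apply x

end LatticeGroup

/-! ### Finite index in the lattice group, by induction on the fixed submodule. -/

section LatticeGroup

variable {V : Type*} [AddCommGroup V] {B : LinearMap.BilinForm ℤ V}

local notation "τ" => symplecticTransvection

variable {d₁ d₂ : V} {U : Submodule ℤ V} {N : ℤ} {Γ : Subgroup (V ≃ₗ[ℤ] V)}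

local notation "L" => pairSpan d₁ d₂ U

/-- The projection of a vector of `P^⊥` to the complement of the hyperbolic pair has a multiple
in `U`. -/
theorem smul_sub_mem_inf_orthogonal (hB : B.IsAlt) (h : IsEvenComplement B d₁ d₂ U N)
    {P : Submodule ℤ V} (hP₁ : ∀ p ∈ P, B p d₁ = 0) (hP₂ : ∀ p ∈ P, B p d₂ = 0) {y : V}
    (hy : y ∈ B.orthogonal P) :
    N • (y - B y d₂ • d₁ - B d₁ y • d₂) ∈ U ⊓ B.orthogonal P := by
  have hd' : B d₂ d₁ = -1 := by rw [form_swap hB, h.pair]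
  refine ⟨h.smul_mem _ ?_ ?_, fun p hp => ?_⟩
  · simp [form_self hB, h.pair]
  · simp [form_self hB, hd', form_swap hB y d₂]
  · change B p _ = 0
    rw [map_smul, map_sub, map_sub, map_smul, map_smul, hP₁ p hp, hP₂ p hp,
      show B p y = 0 from hy p hp]
    simp

variable [Module.Free ℤ V] [Module.Finite ℤ V]

/-- The end of the induction: rationally `V` is spanned by `P`, `d₁` and `d₂`. It remains to fix
`d₁`, then `d₂`; the latter needs a separate orbit count because `d₁`, now fixed, is not orthogonal
to `d₂`. -/
theorem relIndex_ne_zero_of_inf_orthogonal_le (hB : B.IsAlt) (h : IsEvenComplement B d₁ d₂ U N)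
    (hΓ : ∀ v ∈ L, (∃ w ∈ L, B v w = 1) → τ hB v ∈ Γ)
    (hn : ∀ g ∈ latticeGroup B L ⊥, ∀ γ ∈ Γ, g * γ * g⁻¹ ∈ Γ) {P : Submodule ℤ V}
    (hP₁ : ∀ p ∈ P, B p d₁ = 0) (hP₂ : ∀ p ∈ P, B p d₂ = 0)
    (hPV : ∀ x, ∃ c : ℤ, c ≠ 0 ∧ ∃ p ∈ P, ∃ y ∈ B.orthogonal P, c • x = p + y)
    (hU : U ⊓ B.orthogonal P ≤ P) : Γ.relIndex (latticeGroup B L P) ≠ 0 := by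
  have hd' : B d₂ d₁ = -1 := by rw [form_swap hB, h.pair]
  refine relIndex_ne_zero_of_sup_span hB h hΓ hn hP₁ hP₂ right_mem_pairSpan hP₂
    (by rw [h.pair]; exact one_ne_zero) ?_
  set P' := P ⊔ Submodule.span ℤ {d₁} with hP'
  have hd₁P' : d₁ ∈ P' := (le_sup_right : _ ≤ P') (Submodule.mem_span_singleton_self d₁)
  have hPP' : P ≤ P' := le_sup_left
  have hP'₁ : ∀ p ∈ P', B p d₁ = 0 := fun p hp => by
    obtain ⟨q, hq, y, hy, rfl⟩ := Submodule.mem_sup.1 hp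
    obtain ⟨c, rfl⟩ := Submodule.mem_span_singleton.1 hy
    simp [hP₁ q hq, form_self hB]
  obtain ⟨n, f, hf⟩ := exists_finite_residue V (2 * N)
  have hC : 2 * N ≠ 0 := mul_ne_zero two_ne_zero h.ne_zero
  have : NeZero (2 * N).natAbs := ⟨Int.natAbs_ne_zero.2 hC⟩
  -- A multiple of each vector lies in the span of fixed vectors, and `V` is torsion-free.
  have htriv : latticeGroup B L (P' ⊔ Submodule.span ℤ {d₂}) = ⊥ := by
    rw [eq_bot_iff]
    intro g hg
    have hgP : ∀ p ∈ P, g p = p := fun p hp => hg.2.2 p (le_sup_left (a := P') (hPP' hp))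
    have hg₁ : g d₁ = d₁ := hg.2.2 _ (le_sup_left (a := P') hd₁P')
    have hg₂ : g d₂ = d₂ :=
      hg.2.2 _ ((le_sup_right : _ ≤ P' ⊔ _) (Submodule.mem_span_singleton_self d₂))
    rw [Subgroup.mem_bot]
    ext x
    obtain ⟨c, hc, p, hp, y, hy, hxy⟩ := hPV x
    have hu := hgP _ (hU (smul_sub_mem_inf_orthogonal hB h hP₁ hP₂ hy))
    rw [map_smul, map_sub, map_sub, map_smul, map_smul, hg₁, hg₂] at hu
    have hu' := smul_right_injective V h.ne_zero hu
    simp only [sub_left_inj] at hu'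
    refine smul_right_injective V hc ?_
    change c • g x = c • x
    rw [← map_smul, hxy, map_add, hgP p hp, hu']
  refine relIndex_ne_zero_of_stabilizer (fun g hg => hn g (latticeGroup_anti _ bot_le hg))
    (S := latticeGroup B L (P' ⊔ Submodule.span ℤ {d₂})) (by simp [htriv])
    (fun g => f (g d₂)) (Set.toFinite _) ?_
  intro g hg g' hg' hgg
  obtain ⟨z, hz⟩ := hf _ _ hgg
  have hzt : ∀ y ∈ P', B y z = 0 := fun y hy => by
    have := congrArg (B y) hz
    rw [map_sub, form_apply_of_mem_latticeGroup hg hy, form_apply_of_mem_latticeGroup hg' hy,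
      sub_self, map_smul, smul_eq_mul] at this
    exact (mul_eq_zero.1 this.symm).resolve_left hC
  have hzy : N • (z - B z d₂ • d₁) ∈ U ⊓ B.orthogonal P := by
    have := smul_sub_mem_inf_orthogonal hB h hP₁ hP₂ (y := z) fun p hp => hzt p (hPP' hp)
    simpa [hzt d₁ hd₁P'] using this
  set y := N • (z - B z d₂ • d₁) with hy
  have hroot : ∀ w ∈ U ⊓ B.orthogonal P, τ hB (d₁ + w) ∈ Γ ⊓ latticeGroup B L P' := by
    intro w hw
    have hwL : d₁ + w ∈ L := add_mem left_mem_pairSpan (le_pairSpan hw.1)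
    refine ⟨hΓ _ hwL ⟨d₂, right_mem_pairSpan, ?_⟩,
      symplecticTransvection_mem_latticeGroup hB hwL fun p hp => ?_⟩
    · rw [map_add, LinearMap.add_apply, h.pair, form_swap hB, h.right w hw.1]
      simp
    · rw [map_add, hP'₁ p hp, zero_add]
      obtain ⟨q, hq, e, he, rfl⟩ := Submodule.mem_sup.1 hp
      obtain ⟨c, rfl⟩ := Submodule.mem_span_singleton.1 he
      simp [h.left w hw.1, show B q w = 0 from hw.2 q hq]
  have h₁ : τ hB d₁ ∈ Γ ⊓ latticeGroup B L P' := by simpa using hroot 0 (zero_mem _)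
  set E := τ hB (d₁ + -y) * (τ hB (d₁ - -y))⁻¹ with hE
  have hEmem : E ∈ Γ ⊓ latticeGroup B L P' :=
    mul_mem (hroot _ (neg_mem hzy)) (inv_mem (by simpa using hroot y hzy))
  have hg₁ : ∀ g ∈ latticeGroup B L P', B (g d₂) d₁ = -1 := fun g hg => by
    rw [form_swap hB, form_apply_of_mem_latticeGroup hg hd₁P', h.pair]
  obtain ⟨j, hj⟩ : ∃ j : ℤ, (τ hB d₁ ^ j * E) (g d₂) = g' d₂ := by
    -- The exponent corrects the `d₁`-coefficient: one term comes from the Eichler element, the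
    -- other from the `d₁`-component of `z`.
    refine ⟨2 * B (g d₂) (-y) - 2 * N * B z d₂, ?_⟩
    rw [LinearEquiv.mul_apply, hE, eichler_apply hB (by simp [h.left y hzy.1]),
      symplecticTransvection_zpow_apply]
    have hyd : B y d₁ = 0 := by rw [form_swap hB, h.left y hzy.1, neg_zero]
    have : g' d₂ = g d₂ - (2 * N) • z := by rw [← hz]; abel
    rw [this]
    simp only [map_sub, map_smul, map_neg, LinearMap.sub_apply, LinearMap.smul_apply,
      LinearMap.neg_apply, hyd, form_self hB, hg₁ g hg]
    rw [hy]
    simp only [smul_eq_mul]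
    module
  have hK := mul_mem (zpow_mem h₁ j) hEmem
  refine ⟨_, hK.1, mem_latticeGroup_sup_span (mul_mem (mul_mem (inv_mem hg') hK.2) hg) ?_⟩
  have : (g'⁻¹ * (τ hB d₁ ^ j * E) * g) d₂ = g'⁻¹ ((τ hB d₁ ^ j * E) (g d₂)) := rfl
  rw [this, hj]
  exact g'.symm_apply_apply d₂

/-- Ascending induction on `P`. Unless the terminal case applies, adjoin `e, f ∈ U ⊓ P^⊥` with `B e
f ≠ 0`. Each serves as the witness `w` when the other is fixed, and adding them as a pair preserves
the rational splitting into `P` and its complement. -/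
theorem relIndex_latticeGroup_ne_zero (hB : B.IsAlt) (h : IsEvenComplement B d₁ d₂ U N)
    (hΓ : ∀ v ∈ L, (∃ w ∈ L, B v w = 1) → τ hB v ∈ Γ)
    (hn : ∀ g ∈ latticeGroup B L ⊥, ∀ γ ∈ Γ, g * γ * g⁻¹ ∈ Γ) (P : Submodule ℤ V)
    (hP₁ : ∀ p ∈ P, B p d₁ = 0) (hP₂ : ∀ p ∈ P, B p d₂ = 0)
    (hPV : ∀ x, ∃ c : ℤ, c ≠ 0 ∧ ∃ p ∈ P, ∃ y ∈ B.orthogonal P, c • x = p + y)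
    (hrad : ∀ x, (∀ y, B x y = 0) → x ∈ P) : Γ.relIndex (latticeGroup B L P) ≠ 0 := by
  induction P using WellFoundedGT.induction with
  | ind P ih =>
    by_cases hU : U ⊓ B.orthogonal P ≤ P
    · exact relIndex_ne_zero_of_inf_orthogonal_le hB h hΓ hn hP₁ hP₂ hPV hU
    obtain ⟨e, ⟨heU, heP⟩, hne⟩ := SetLike.not_le_iff_exists.1 hU
    obtain ⟨z, hz⟩ : ∃ z, B e z ≠ 0 := by
      by_contra! hcon
      exact hne (hrad e hcon)
    obtain ⟨c, hc, p, hp, y, hy, hzy⟩ := hPV z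
    have hey : B e y ≠ 0 := by
      have := congrArg (B e) hzy
      rw [map_smul, map_add, form_swap hB e p, show B p e = 0 from heP p hp, neg_zero,
        zero_add] at this
      rw [← this]
      exact smul_ne_zero hc hz
    obtain ⟨hfU, hfP⟩ := smul_sub_mem_inf_orthogonal hB h hP₁ hP₂ hy
    set f := N • (y - B y d₂ • d₁ - B d₁ y • d₂) with hf
    have hed₁ : B e d₁ = 0 := by rw [form_swap hB, h.left e heU, neg_zero]
    have hed₂ : B e d₂ = 0 := by rw [form_swap hB, h.right e heU, neg_zero]
    have hfd₁ : B f d₁ = 0 := by rw [form_swap hB, h.left f hfU, neg_zero]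
    have hfd₂ : B f d₂ = 0 := by rw [form_swap hB, h.right f hfU, neg_zero]
    have hef : B e f ≠ 0 := by
      rw [hf, map_smul, map_sub, map_sub, map_smul, map_smul, hed₁, hed₂]
      simpa using ⟨h.ne_zero, hey⟩
    have hfe : B f e ≠ 0 := by rw [form_swap hB]; exact neg_ne_zero.2 hef
    have hsup : ∀ {Q : Submodule ℤ V} {x v : V}, (∀ p ∈ Q, B p v = 0) → B x v = 0 →
        ∀ p ∈ Q ⊔ Submodule.span ℤ {x}, B p v = 0 := fun hQ hx p hp => by
      obtain ⟨q, hq, t, ht, rfl⟩ := Submodule.mem_sup.1 hp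
      obtain ⟨c, rfl⟩ := Submodule.mem_span_singleton.1 ht
      simp [hQ q hq, hx]
    have hQ₁ := hsup hP₁ hed₁
    have hQ₂ := hsup hP₂ hed₂
    refine relIndex_ne_zero_of_sup_span hB h hΓ hn hP₁ hP₂ (le_pairSpan hfU)
      hfP hef ?_
    refine relIndex_ne_zero_of_sup_span hB h hΓ hn hQ₁ hQ₂ (le_pairSpan heU)
      (hsup heP (form_self hB e)) hfe ?_
    set P' := P ⊔ Submodule.span ℤ {e} ⊔ Submodule.span ℤ {f} with hP'
    have hPP' : P ≤ P' := le_sup_left.trans le_sup_left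
    have heP' : e ∈ P' := (le_sup_right.trans le_sup_left : Submodule.span ℤ {e} ≤ P')
      (Submodule.mem_span_singleton_self e)
    have hfP' : f ∈ P' := (le_sup_right : Submodule.span ℤ {f} ≤ P')
      (Submodule.mem_span_singleton_self f)
    refine ih P' (lt_of_le_of_ne hPP' fun heq => hne (heq ▸ heP')) (hsup hQ₁ hfd₁)
      (hsup hQ₂ hfd₂) (fun x => ?_) fun x hx => hPP' (hrad x hx)
    obtain ⟨c, hc, p, hp, y, hy, hxy⟩ := hPV x
    set m := B e f with hm
    have hfe' : B f e = -m := by rw [form_swap hB]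
    -- Orthogonal projection away from the plane of `e, f`, cleared of the denominator `m = B e f`.
    refine ⟨m * c, mul_ne_zero hef hc, m • p - B y e • f + B y f • e,
      P'.add_mem (P'.sub_mem (P'.smul_mem _ (hPP' hp)) (P'.smul_mem _ hfP'))
        (P'.smul_mem _ heP'),
      m • y + B y e • f - B y f • e, ?_, ?_⟩
    · refine hsup (hsup (fun q hq => ?_) ?_) ?_
      · simp [show B q y = 0 from hy q hq, show B q e = 0 from heP q hq,
          show B q f = 0 from hfP q hq]
      · simp only [map_sub, map_add, map_smul, form_self hB, ← hm, smul_eq_mul]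
        rw [form_swap hB e y]
        ring
      · simp only [map_sub, map_add, map_smul, form_self hB, hfe', smul_eq_mul]
        rw [form_swap hB f y]
        ring
    · rw [mul_smul, hxy]
      module

end LatticeGroup

/-! ### Translations and the additivity of roots. -/

section Translations

variable {V : Type*} [AddCommGroup V] {B : LinearMap.BilinForm ℤ V}

local notation "τ" => symplecticTransvection

variable {d₁ d₂ : V} {Γ : Subgroup (V ≃ₗ[ℤ] V)}

variable (B d₁ d₂) in
/-- The vectors `z` orthogonal to the hyperbolic pair such that translation by `z` preserves
the set of those `y` orthogonal to the pair with `d₁ + y ∈ X`. -/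
def translationLattice (X : Set V) : Submodule ℤ V :=
  AddSubgroup.toIntSubmodule
    { carrier := {z | B d₁ z = 0 ∧ B d₂ z = 0 ∧
        ∀ y, B d₁ y = 0 → B d₂ y = 0 → (d₁ + y ∈ X ↔ d₁ + (y + z) ∈ X)}
      add_mem' := fun {a b} ha hb => ⟨by rw [map_add, ha.1, hb.1, add_zero],
        by rw [map_add, ha.2.1, hb.2.1, add_zero], fun y hy₁ hy₂ => by
          rw [ha.2.2 y hy₁ hy₂, hb.2.2 (y + a) (by rw [map_add, hy₁, ha.1, add_zero])
            (by rw [map_add, hy₂, ha.2.1, add_zero]), add_assoc y]⟩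
      zero_mem' := ⟨map_zero _, map_zero _, fun y _ _ => by rw [add_zero]⟩
      neg_mem' := fun {a} ha => ⟨by rw [map_neg, ha.1, neg_zero],
        by rw [map_neg, ha.2.1, neg_zero], fun y hy₁ hy₂ => by
          rw [ha.2.2 (y + -a) (by rw [map_add, map_neg, hy₁, ha.1, neg_zero, add_zero])
            (by rw [map_add, map_neg, hy₂, ha.2.1, neg_zero, add_zero]), neg_add_cancel_right]⟩ }

theorem mem_translationLattice {X : Set V} {z : V} :
    z ∈ translationLattice B d₁ d₂ X ↔ B d₁ z = 0 ∧ B d₂ z = 0 ∧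
      ∀ y, B d₁ y = 0 → B d₂ y = 0 → (d₁ + y ∈ X ↔ d₁ + (y + z) ∈ X) :=
  Iff.rfl

theorem symplecticTransvection_apply_mem (hB : B.IsAlt) (hΓ : Γ ≤ isometryGroup B)
    {g : V ≃ₗ[ℤ] V} (hg : g ∈ Γ) {v : V} (hv : τ hB v ∈ Γ) : τ hB (g v) ∈ Γ := by
  rw [← conj_symplecticTransvection hB (hΓ hg)]
  exact mul_mem (mul_mem hg hv) (inv_mem hg)

theorem quarterTurn_smul_add (hB : B.IsAlt) (hd : B d₁ d₂ = 1) {u : V} (hu₁ : B d₁ u = 0)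
    (hu₂ : B d₂ u = 0) (a b : ℤ) :
    quarterTurn hB d₁ d₂ (a • d₁ + b • d₂ + u) = b • d₁ + (-a) • d₂ + u := by
  have : B u d₂ = 0 := by rw [form_swap hB, hu₂, neg_zero]
  rw [quarterTurn_apply hB hd]
  simp only [map_add, map_smul, LinearMap.add_apply, LinearMap.smul_apply, form_self hB, hd, this,
    hu₁, smul_eq_mul]
  module

/-- Rotations of a root by the hyperbolic plane are roots. -/
theorem symplecticTransvection_rotate_mem (hB : B.IsAlt) (hd : B d₁ d₂ = 1)
    (hΓ : Γ ≤ isometryGroup B) (h₁ : τ hB d₁ ∈ Γ) (h₂ : τ hB d₂ ∈ Γ) {u : V} (hu₁ : B d₁ u = 0)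
    (hu₂ : B d₂ u = 0) {a b : ℤ} (hv : τ hB (a • d₁ + b • d₂ + u) ∈ Γ) :
    τ hB (b • d₁ + (-a) • d₂ + u) ∈ Γ := by
  rw [← quarterTurn_smul_add hB hd hu₁ hu₂]
  exact symplecticTransvection_apply_mem hB hΓ (quarterTurn_mem hB h₁ h₂) hv

/-- Rotating the root gives the roots `a • d₂ ± u`. Their Eichler element shifts `d₁ + y` by a
multiple `±2a` of `u` and by a multiple of `d₂`, which a power of `T_{d₂}` removes. -/
theorem smul_mem_translationLattice (hB : B.IsAlt) (hd : B d₁ d₂ = 1)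
    (hΓ : Γ ≤ isometryGroup B) (h₁ : τ hB d₁ ∈ Γ) (h₂ : τ hB d₂ ∈ Γ) {X : Set V}
    (hX : ∀ g ∈ Γ, ∀ x ∈ X, g x ∈ X) {u : V} (hu₁ : B d₁ u = 0) (hu₂ : B d₂ u = 0) {a : ℤ}
    (hv : τ hB (a • d₁ + u) ∈ Γ) : (2 * a) • u ∈ translationLattice B d₁ d₂ X := by
  have hr₀ : τ hB (a • d₁ + (0 : ℤ) • d₂ + u) ∈ Γ := by simpa using hv
  have hr₁ := symplecticTransvection_rotate_mem hB hd hΓ h₁ h₂ hu₁ hu₂ hr₀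
  have hr₂ := symplecticTransvection_rotate_mem hB hd hΓ h₁ h₂ hu₁ hu₂ hr₁
  have hr₃ := symplecticTransvection_rotate_mem hB hd hΓ h₁ h₂ hu₁ hu₂ hr₂
  have hud : B u d₂ = 0 := by rw [form_swap hB, hu₂, neg_zero]
  have key : ∀ ε : ℤ, τ hB (a • d₂ + ε • u) ∈ Γ → τ hB (a • d₂ - ε • u) ∈ Γ →
      ∀ y, B d₁ y = 0 → B d₂ y = 0 → d₁ + y ∈ X → d₁ + (y - (ε * (2 * a)) • u) ∈ X := by
    intro ε hε hε' y hy₁ hy₂ hy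
    have hyd : B y d₂ = 0 := by rw [form_swap hB, hy₂, neg_zero]
    have := hX _ (mul_mem (zpow_mem h₂ (-(2 * B y (ε • u) * a))) (mul_mem hε (inv_mem hε'))) _ hy
    rw [LinearEquiv.mul_apply, eichler_apply hB (by simp [hu₂]),
      symplecticTransvection_zpow_apply] at this
    convert this using 1
    simp only [map_add, map_sub, map_smul, LinearMap.add_apply, LinearMap.sub_apply,
      LinearMap.smul_apply, form_self hB, hd, hud, hyd, hu₁, smul_eq_mul]
    module
  have hp : τ hB (a • d₂ + (1 : ℤ) • u) ∈ Γ := by simpa using hr₃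
  have hm : τ hB (a • d₂ - (1 : ℤ) • u) ∈ Γ := by
    rw [← symplecticTransvection_neg]
    convert hr₁ using 2
    module
  refine mem_translationLattice.2 ⟨by simp [hu₁], by simp [hu₂], fun y hy₁ hy₂ => ⟨fun h => ?_,
    fun h => ?_⟩⟩
  · convert key (-1) (by convert hm using 2; module) (by convert hp using 2; module) y hy₁ hy₂ h
      using 2
    module
  · convert key 1 hp hm (y + (2 * a) • u) (by simp [hy₁, hu₁]) (by simp [hy₂, hu₂]) h using 2
    module

/-- If `d₁ + s` is a root for generators `s` of a lattice on which the form is even, then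
`d₁ + u` is a root for all elements `u` of the lattice. -/
theorem symplecticTransvection_add_mem (hB : B.IsAlt) (hd : B d₁ d₂ = 1)
    (hΓ : Γ ≤ isometryGroup B) (h₁ : τ hB d₁ ∈ Γ) (h₂ : τ hB d₂ ∈ Γ) {S : Set V}
    (hS₁ : ∀ u ∈ Submodule.span ℤ S, B d₁ u = 0) (hS₂ : ∀ u ∈ Submodule.span ℤ S, B d₂ u = 0)
    (heven : ∀ u ∈ Submodule.span ℤ S, ∀ w ∈ Submodule.span ℤ S, 2 ∣ B u w)
    (hS : ∀ s ∈ S, τ hB (d₁ + s) ∈ Γ) {u : V} (hu : u ∈ Submodule.span ℤ S) :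
    τ hB (d₁ + u) ∈ Γ := by
  let D : AddSubgroup V :=
    { carrier := {u | u ∈ Submodule.span ℤ S ∧ τ hB (d₁ + u) ∈ Γ}
      zero_mem' := ⟨zero_mem _, by simpa using h₁⟩
      neg_mem' := fun {u} hu => by
        have hu₁ := hS₁ u hu.1
        have hu₂ := hS₂ u hu.1
        have h₀ : τ hB ((1 : ℤ) • d₁ + (0 : ℤ) • d₂ + u) ∈ Γ := by simpa using hu.2
        have := symplecticTransvection_rotate_mem hB hd hΓ h₁ h₂ hu₁ hu₂
          (symplecticTransvection_rotate_mem hB hd hΓ h₁ h₂ hu₁ hu₂ h₀)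
        refine ⟨neg_mem hu.1, ?_⟩
        rw [← symplecticTransvection_neg]
        convert this using 2
        module
      add_mem' := fun {u w} hu hw => by
        refine ⟨add_mem hu.1 hw.1, ?_⟩
        have hu₁ := hS₁ u hu.1
        have hu₂ := hS₂ u hu.1
        have hw₁ := hS₁ w hw.1
        have hw₂ := hS₂ w hw.1
        have h₀ : τ hB ((1 : ℤ) • d₁ + (0 : ℤ) • d₂ + w) ∈ Γ := by simpa using hw.2
        have hr₃ := symplecticTransvection_rotate_mem hB hd hΓ h₁ h₂ hw₁ hw₂
          (symplecticTransvection_rotate_mem hB hd hΓ h₁ h₂ hw₁ hw₂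
            (symplecticTransvection_rotate_mem hB hd hΓ h₁ h₂ hw₁ hw₂ h₀))
        obtain ⟨k, hk⟩ := heven w hw.1 u hu.1
        set y := w + (1 - 2 * k) • u with hy
        have hy₁ : B d₁ y = 0 := by simp [hy, hu₁, hw₁]
        have hy₂ : B d₂ y = 0 := by simp [hy, hu₂, hw₂]
        have hyd : B y d₂ = 0 := by rw [form_swap hB, hy₂, neg_zero]
        -- Apply `T_{d₁ + u}` to the root `d₂ + w`. Since `B w u = 2 * k`, rotating and clearing the
        -- `d₂`-component gives the root `d₁ + w + (1 - 2 * k) • u`; the excess is a multiple of the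
        -- allowed translation `2 • u`.
        have hv := symplecticTransvection_apply_mem hB hΓ hu.2 hr₃
        have hv' : τ hB ((1 - 2 * k) • d₁ + (1 : ℤ) • d₂ + y) ∈ Γ := by
          convert hv using 2
          have hd' : B d₂ d₁ = -1 := by rw [form_swap hB, hd]
          have hwd : B w d₁ = 0 := by rw [form_swap hB, hw₁, neg_zero]
          rw [symplecticTransvection_apply]
          simp only [map_add, map_smul, LinearMap.add_apply, LinearMap.smul_apply, form_self hB,
            hd', hwd, hu₁, hu₂, hk, hy, smul_eq_mul]
          module
        have ht := symplecticTransvection_rotate_mem hB hd hΓ h₁ h₂ hy₁ hy₂ hv'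
        have hroot : τ hB (d₁ + y) ∈ Γ := by
          convert symplecticTransvection_apply_mem hB hΓ (zpow_mem h₂ (-(1 - 2 * k))) ht using 2
          rw [symplecticTransvection_zpow_apply]
          simp only [map_add, map_smul, LinearMap.add_apply, LinearMap.smul_apply, form_self hB,
            hd, hyd, smul_eq_mul]
          module
        have htr := smul_mem_translationLattice hB hd hΓ h₁ h₂ (X := {v | τ hB v ∈ Γ})
          (fun g hg x hx => symplecticTransvection_apply_mem hB hΓ hg hx) hu₁ hu₂ (a := 1)
          (by simpa using hu.2)
        have := ((mem_translationLattice.1 (Submodule.smul_mem _ k htr)).2.2 y hy₁ hy₂).1 hroot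
        change τ hB _ ∈ Γ at this
        convert this using 2
        rw [hy]
        module }
  have hle : Submodule.span ℤ S ≤ AddSubgroup.toIntSubmodule D :=
    Submodule.span_le.2 fun s hs => ⟨Submodule.subset_span hs, hS s hs⟩
  exact (hle hu).2

end Translations

/-! ### Unimodular vectors are roots; normality and comparison of groups. -/

section Normal

variable {V : Type*} [AddCommGroup V] {B : LinearMap.BilinForm ℤ V}

local notation "τ" => symplecticTransvection

variable {d₁ d₂ : V} {U : Submodule ℤ V} {N : ℤ}

local notation "L" => pairSpan d₁ d₂ U

/-- Every unimodular vector of the lattice is a root. -/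
theorem symplecticTransvection_mem_of_unimodular (hB : B.IsAlt)
    (h : IsEvenComplement B d₁ d₂ U N) {Γ : Subgroup (V ≃ₗ[ℤ] V)}
    (hΓ : Γ ≤ latticeGroup B L ⊥) (h₂ : τ hB d₂ ∈ Γ) (hU : ∀ u ∈ U, τ hB (d₁ + u) ∈ Γ) {v : V}
    (hv : v ∈ L) (hvw : ∃ w ∈ L, B v w = 1) : τ hB v ∈ Γ := by
  have hΓB : Γ ≤ isometryGroup B := fun g hg => (hΓ hg).1
  have h₁ : τ hB d₁ ∈ Γ := by simpa using hU 0 (zero_mem _)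
  obtain ⟨w, hw, hvw⟩ := hvw
  have hU₂ : ∀ u ∈ U, τ hB (d₂ + u) ∈ Γ := by
    intro u hu
    have hu₁ := h.left u hu
    have hu₂ := h.right u hu
    have h₀ : τ hB ((1 : ℤ) • d₁ + (0 : ℤ) • d₂ + u) ∈ Γ := by simpa using hU u hu
    have := symplecticTransvection_rotate_mem hB h.pair hΓB h₁ h₂ hu₁ hu₂
      (symplecticTransvection_rotate_mem hB h.pair hΓB h₁ h₂ hu₁ hu₂
        (symplecticTransvection_rotate_mem hB h.pair hΓB h₁ h₂ hu₁ hu₂ h₀))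
    simpa using this
  obtain ⟨k, hk, -, hk₁, hkd⟩ := exists_reduced hB h.pair h₁ h₂ h.left h.right hU₂ v (by
    by_contra! hcon
    obtain ⟨hc₁, hc₂, hc⟩ := hcon
    have := hc _ (sub_mem_of_mem_pairSpan hB h hw)
    rw [map_sub, map_sub, map_smul, map_smul, hc₁, form_swap hB v d₁, hc₂, hvw] at this
    simp at this)
  have hu := sub_mem_of_mem_pairSpan hB h (((hΓ hk).2.1 v).2 hv)
  have hy := sub_mem_of_mem_pairSpan hB h (((hΓ hk).2.1 w).2 hw)
  set a := B (k v) d₂ with ha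
  rw [hk₁, zero_smul, sub_zero] at hu
  set u := k v - a • d₁ with hudef
  set y := k w - B (k w) d₂ • d₁ - B d₁ (k w) • d₂ with hydef
  have hkv : k v = a • d₁ + u := by rw [hudef]; abel
  have hby : B (k v) y = B u y := by
    rw [hkv, map_add, map_smul, LinearMap.add_apply, LinearMap.smul_apply, h.left y hy, smul_zero,
      zero_add]
  obtain ⟨t, ht⟩ := h.even u hu y hy
  have hone : B d₁ (k w) * a + t * 2 = 1 := by
    have h1 := (hΓB hk) v w
    rw [hvw, show k w = y + B (k w) d₂ • d₁ + B d₁ (k w) • d₂ by rw [hydef]; abel, map_add,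
      map_add, map_smul, map_smul, hby, ht, ← ha, form_swap hB _ d₁, hk₁] at h1
    simp only [smul_eq_mul, neg_zero, mul_zero, add_zero] at h1
    linarith
  -- Evenness of `B u y = 2 * t` makes `a` odd, so `a ∣ 4 * t` improves to `a ∣ 2 * t`. The relation
  -- `hone` then makes `a` a unit, and `k v` is `±(d₁ + u')` with `u' ∈ U`.
  have hdvd : a ∣ 2 * t := by
    refine IsCoprime.dvd_of_dvd_mul_left ⟨_, _, hone⟩ ?_
    rw [← ht, ← hby]
    exact hkd y hy
  have hunit : IsUnit a := by
    refine isUnit_of_dvd_one ?_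
    rw [← hone]
    exact dvd_add (dvd_mul_left _ _) (by rwa [mul_comm])
  have hroot : τ hB (k v) ∈ Γ := by
    rw [hkv]
    obtain h1 | h1 := Int.isUnit_iff.1 hunit
    · rw [h1, one_smul]
      exact hU u hu
    · rw [h1, ← symplecticTransvection_neg]
      convert hU (-u) (neg_mem hu) using 2
      module
  have := symplecticTransvection_apply_mem hB hΓB (inv_mem hk) hroot
  rwa [show k⁻¹ (k v) = v from k.symm_apply_apply v] at this

theorem transvectionGroup_relIndex_latticeGroup_ne_zero [Module.Free ℤ V] [Module.Finite ℤ V]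
    (hB : B.IsAlt) {R S : Set V} (h : IsEvenComplement B d₁ d₂ (Submodule.span ℤ S) N)
    (hR : ∀ v ∈ R, v ∈ pairSpan d₁ d₂ (Submodule.span ℤ S) ∧
      ∃ w ∈ pairSpan d₁ d₂ (Submodule.span ℤ S), B v w = 1)
    (h₁ : d₁ ∈ R) (h₂ : d₂ ∈ R) (hS : ∀ s ∈ S, d₁ + s ∈ R) :
    (transvectionGroup hB R).relIndex
      (latticeGroup B (pairSpan d₁ d₂ (Submodule.span ℤ S)) (LinearMap.ker B)) ≠ 0 := by
  have hle : transvectionGroup hB R ≤ latticeGroup B (pairSpan d₁ d₂ (Submodule.span ℤ S)) ⊥ := by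
    rw [transvectionGroup, Subgroup.closure_le]
    rintro _ ⟨v, hv, rfl⟩
    refine symplecticTransvection_mem_latticeGroup hB (hR v hv).1 fun p hp => ?_
    rw [(Submodule.mem_bot ℤ).1 hp, map_zero, LinearMap.zero_apply]
  have hmem : ∀ v ∈ R, τ hB v ∈ transvectionGroup hB R :=
    fun v hv => symplecticTransvection_mem_of_mem hB hv
  have hroot : ∀ v ∈ pairSpan d₁ d₂ (Submodule.span ℤ S),
      (∃ w ∈ pairSpan d₁ d₂ (Submodule.span ℤ S), B v w = 1) →
        τ hB v ∈ transvectionGroup hB R := fun v hv hvw =>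
    symplecticTransvection_mem_of_unimodular hB h hle (hmem _ h₂) (fun u hu =>
      symplecticTransvection_add_mem hB h.pair (transvectionGroup_le_isometryGroup hB R)
        (hmem _ h₁) (hmem _ h₂) h.left h.right h.even (fun s hs => hmem _ (hS s hs)) hu) hv hvw
  refine relIndex_latticeGroup_ne_zero hB h hroot ?_ _ ?_ ?_ ?_ ?_
  · intro g hg γ hγ
    -- Conjugation by `g` sends `T_v` to `T_{g v}`, and `g v` is again a unimodular vector of the
    -- lattice.
    have : transvectionGroup hB R ≤ (transvectionGroup hB R).comap (MulAut.conj g).toMonoidHom := by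
      conv_lhs => rw [transvectionGroup]
      rw [Subgroup.closure_le]
      rintro _ ⟨v, hv, rfl⟩
      change g * τ hB v * g⁻¹ ∈ transvectionGroup hB R
      rw [conj_symplecticTransvection hB hg.1]
      obtain ⟨hv, w, hw, hvw⟩ := hR v hv
      exact hroot _ ((hg.2.1 v).2 hv) ⟨g w, (hg.2.1 w).2 hw, (hg.1 v w).trans hvw⟩
    exact this hγ
  · intro p hp
    rw [LinearMap.mem_ker.1 hp, LinearMap.zero_apply]
  · intro p hp
    rw [LinearMap.mem_ker.1 hp, LinearMap.zero_apply]
  · intro x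
    refine ⟨1, one_ne_zero, 0, zero_mem _, x, fun p hp => ?_, by simp⟩
    change B p x = 0
    rw [LinearMap.mem_ker.1 hp, LinearMap.zero_apply]
  · intro x hx
    exact LinearMap.mem_ker.2 (LinearMap.ext hx)

/-- The stabiliser of a lattice of finite exponent has finite index. -/
theorem latticeGroup_relIndex_ne_zero [Module.Free ℤ V] [Module.Finite ℤ V] (hB : B.IsAlt)
    (Δ : Set V) {Λ : Submodule ℤ V} {C : ℤ} (hC : C ≠ 0) (hΛ : ∀ x, C • x ∈ Λ) :
    (latticeGroup B Λ (LinearMap.ker B)).relIndex (transvectionGroup hB Δ) ≠ 0 := by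
  have hker : ∀ g ∈ transvectionGroup hB Δ, ∀ p ∈ LinearMap.ker B, g p = p := by
    have : transvectionGroup hB Δ ≤ latticeGroup B ⊤ (LinearMap.ker B) := by
      rw [transvectionGroup, Subgroup.closure_le]
      rintro _ ⟨v, hv, rfl⟩
      refine symplecticTransvection_mem_latticeGroup hB trivial fun p hp => ?_
      rw [LinearMap.mem_ker.1 hp, LinearMap.zero_apply]
    exact fun g hg => (this hg).2.2
  -- There are finitely many endomorphisms modulo `C`. If `g ≡ g'`, then `g⁻¹ * g'` is the identity
  -- modulo `C • V ⊆ Λ`, so it preserves `Λ`.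
  obtain ⟨n, f, hf⟩ := exists_finite_residue (V →ₗ[ℤ] V) C
  have : NeZero C.natAbs := ⟨Int.natAbs_ne_zero.2 hC⟩
  refine relIndex_ne_zero_of_finite_image (fun g : V ≃ₗ[ℤ] V => f g.toLinearMap)
    (Set.toFinite _) fun g hg g' hg' hgg => ?_
  have hmem := mul_mem (inv_mem hg) hg'
  refine ⟨transvectionGroup_le_isometryGroup hB Δ hmem, fun x => ?_, hker _ hmem⟩
  obtain ⟨ψ, hψ⟩ := hf _ _ hgg
  have hx : (g⁻¹ * g') x = x - C • g⁻¹ (ψ x) := by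
    have h1 : g x - g' x = C • ψ x := LinearMap.congr_fun hψ x
    have h2 : g' x = g x - C • ψ x := by rw [← h1]; abel
    rw [LinearEquiv.mul_apply, h2, map_sub, map_smul]
    congr 1
    exact g.symm_apply_apply x
  rw [hx]
  exact Submodule.sub_mem_iff_left Λ (hΛ _)

end Normal

/-! ### Many elements of a vanishing lattice. -/

section Existence

variable {V : Type*} [AddCommGroup V] {B : LinearMap.BilinForm ℤ V}

local notation "τ" => symplecticTransvection

variable {d₁ d₂ : V} {Δ : Set V}

theorem IsVanishingLattice.apply_mem {hB : B.IsAlt} (hΔ : IsVanishingLattice hB Δ) :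
    ∀ g ∈ transvectionGroup hB Δ, ∀ x ∈ Δ, g x ∈ Δ := by
  intro g hg x hx
  obtain ⟨δ, hδ⟩ := hΔ.single_orbit
  rw [hδ] at hx
  obtain ⟨γ, rfl⟩ := hx
  have : g ((fun m : transvectionGroup hB Δ => m • δ) γ) ∈
      MulAction.orbit (transvectionGroup hB Δ) δ := ⟨⟨g, hg⟩ * γ, rfl⟩
  rwa [← hδ] at this

theorem IsVanishingLattice.exists_apply_eq {hB : B.IsAlt} (hΔ : IsVanishingLattice hB Δ) {x y : V}
    (hx : x ∈ Δ) (hy : y ∈ Δ) : ∃ g ∈ transvectionGroup hB Δ, g x = y := by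
  obtain ⟨δ, hδ⟩ := hΔ.single_orbit
  rw [hδ] at hx hy
  rw [← MulAction.orbit_eq_iff.2 hx] at hy
  obtain ⟨γ, hγ⟩ := hy
  exact ⟨γ, γ.2, hγ⟩

/-- The elements of a vanishing lattice that are not orthogonal to a given hyperbolic pair
generate the lattice. -/
theorem IsVanishingLattice.span_not_orthogonal {hB : B.IsAlt} (hΔ : IsVanishingLattice hB Δ)
    (hd : B d₁ d₂ = 1) (h₁ : d₁ ∈ Δ) :
    Submodule.span ℤ {x | x ∈ Δ ∧ (B x d₂ ≠ 0 ∨ B d₁ x ≠ 0)} = ⊤ := by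
  set A := {x | x ∈ Δ ∧ (B x d₂ ≠ 0 ∨ B d₁ x ≠ 0)} with hA
  set W := Submodule.span ℤ A with hW
  have horth : ∀ v ∈ Δ, v ∉ W → ∀ x ∈ W, B x v = 0 := by
    intro v hv hvW
    have hvA : ¬(B v d₂ ≠ 0 ∨ B d₁ v ≠ 0) := fun h => hvW (Submodule.subset_span ⟨hv, h⟩)
    push Not at hvA
    have hsub : W ≤ LinearMap.ker (B.flip v) := by
      refine Submodule.span_le.2 fun x hx => ?_
      change B x v = 0
      by_contra hxv
      have hvx : B v x ≠ 0 := by rw [form_swap hB]; exact neg_ne_zero.2 hxv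
      refine hvW ?_
      -- `T_x v = v - B v x • x` lies in `Δ` and inherits from `x` a nonzero pairing with `d₁` or
      -- `d₂`. It therefore lies in `W`, which forces `v ∈ W`.
      have hmem : τ hB x v ∈ A := by
        refine ⟨hΔ.apply_mem _ (symplecticTransvection_mem_of_mem hB hx.1) v hv, ?_⟩
        rw [symplecticTransvection_apply]
        simp only [map_sub, map_smul, LinearMap.sub_apply, LinearMap.smul_apply, hvA.1, hvA.2,
          zero_sub, smul_eq_mul, ne_eq, neg_eq_zero]
        exact hx.2.imp (mul_ne_zero hvx) (mul_ne_zero hvx)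
      have := Submodule.subset_span (R := ℤ) hmem
      rw [symplecticTransvection_apply] at this
      exact (Submodule.sub_mem_iff_left W (W.smul_mem _ (Submodule.subset_span hx))).1 this
    exact fun x hx => hsub hx
  -- Each generator `T_v` either has `v ∈ W` or acts trivially on `W`. As `d₁ ∈ W`, its whole orbit
  -- `Δ` lies in `W`.
  have hstable : ∀ g ∈ transvectionGroup hB Δ, ∀ x, g x ∈ W ↔ x ∈ W := by
    intro g hg
    induction hg using Subgroup.closure_induction with
    | mem g hg =>
      obtain ⟨v, hv, rfl⟩ := hg
      intro x
      by_cases hvW : v ∈ W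
      · rw [symplecticTransvection_apply]
        exact Submodule.sub_mem_iff_left W (W.smul_mem _ hvW)
      · have hfix : ∀ x, B x v = 0 → τ hB v x = x := fun x hx => by
          rw [symplecticTransvection_apply, hx, zero_smul, sub_zero]
        refine ⟨fun hx => ?_, fun hx => by rwa [hfix x (horth v hv hvW x hx)]⟩
        have := horth v hv hvW _ hx
        rw [symplecticTransvection_apply, map_sub, map_smul, LinearMap.sub_apply,
          LinearMap.smul_apply, form_self hB, smul_zero, sub_zero] at this
        rwa [hfix x this] at hx
    | one => exact fun _ => Iff.rfl
    | mul a b _ _ ha hb => exact fun x => (ha (b x)).trans (hb x)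
    | inv a _ ha =>
      intro x
      rw [← ha (a⁻¹ x), ← LinearEquiv.mul_apply, mul_inv_cancel, LinearEquiv.coe_one, id]
  rw [eq_top_iff, ← hΔ.span_eq_top, Submodule.span_le]
  intro x hx
  obtain ⟨g, hg, rfl⟩ := hΔ.exists_apply_eq h₁ hx
  exact (hstable g hg d₁).2 (Submodule.subset_span ⟨h₁, Or.inl (by rw [hd]; exact one_ne_zero)⟩)

/-- Vectors with a nonzero multiple mapping into `J` form a submodule; the product of the
multipliers over a finite basis is uniform. -/
theorem exists_smul_apply_mem {W : Type*} [AddCommGroup W] [Module.Free ℤ W] [Module.Finite ℤ W]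
    (f : W →ₗ[ℤ] V) (J : Submodule ℤ V) {S : Set W} (hS : Submodule.span ℤ S = ⊤)
    (h : ∀ x ∈ S, ∃ n : ℤ, n ≠ 0 ∧ n • f x ∈ J) : ∃ n : ℤ, n ≠ 0 ∧ ∀ x, n • f x ∈ J := by
  have hall : ∀ x, ∃ n : ℤ, n ≠ 0 ∧ n • f x ∈ J := by
    intro x
    have hx : x ∈ Submodule.span ℤ S := hS ▸ trivial
    induction hx using Submodule.span_induction with
    | mem x hx => exact h x hx
    | zero => exact ⟨1, one_ne_zero, by simp⟩
    | add x y _ _ hx hy =>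
      obtain ⟨n, hn, hnx⟩ := hx
      obtain ⟨m, hm, hmy⟩ := hy
      refine ⟨m * n, mul_ne_zero hm hn, ?_⟩
      have := add_mem (J.smul_mem m hnx) (J.smul_mem n hmy)
      convert this using 1
      rw [map_add]
      module
    | smul a x _ hx =>
      obtain ⟨n, hn, hnx⟩ := hx
      refine ⟨n, hn, ?_⟩
      rw [map_smul, smul_comm]
      exact J.smul_mem a hnx
  let b := Module.finBasis ℤ W
  choose n hn hnb using fun i => hall (b i)
  refine ⟨∏ i, n i, Finset.prod_ne_zero_iff.2 fun i _ => hn i, fun x => ?_⟩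
  rw [← b.sum_repr x, map_sum, Finset.smul_sum]
  refine sum_mem fun i _ => ?_
  rw [map_smul, smul_comm]
  refine J.smul_mem _ ?_
  obtain ⟨c, hc⟩ := Finset.dvd_prod_of_mem n (Finset.mem_univ i)
  rw [hc, mul_comm, mul_smul]
  exact J.smul_mem c (hnb i)

/-- A vanishing lattice contains all translates of `d₁` by a sublattice of finite exponent in the
orthogonal complement of a hyperbolic pair. -/
theorem IsVanishingLattice.exists_add_smul_mem [Module.Free ℤ V] [Module.Finite ℤ V]
    {hB : B.IsAlt} (hΔ : IsVanishingLattice hB Δ) (hd : B d₁ d₂ = 1) (h₁ : d₁ ∈ Δ) (h₂ : d₂ ∈ Δ) :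
    ∃ n : ℤ, n ≠ 0 ∧ ∀ x, B d₁ x = 0 → B d₂ x = 0 → d₁ + n • x ∈ Δ := by
  have hd' : B d₂ d₁ = -1 := by rw [form_swap hB, hd]
  let π : V →ₗ[ℤ] V := LinearMap.id - (B.flip d₂).smulRight d₁ - (B d₁).smulRight d₂
  have hπ : ∀ x, π x = x - B x d₂ • d₁ - B d₁ x • d₂ := fun x => rfl
  have hπk : ∀ k ∈ transvectionGroup hB {d₁, d₂}, ∀ x, π (k x) = π x := by
    intro k hk
    induction hk using Subgroup.closure_induction with
    | mem g hg =>
      obtain ⟨v, hv, rfl⟩ := hg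
      intro x
      have : π v = 0 := by
        rcases hv with rfl | rfl
        · simp [hπ, hd, form_self hB]
        · simp [hπ, hd, form_self hB]
      rw [symplecticTransvection_apply, map_sub, map_smul, this, smul_zero, sub_zero]
    | one => exact fun _ => rfl
    | mul a b _ _ ha hb => exact fun x => (ha (b x)).trans (hb x)
    | inv a _ ha =>
      intro x
      rw [← ha (a⁻¹ x), ← LinearEquiv.mul_apply, mul_inv_cancel, LinearEquiv.coe_one, id]
  have hle : transvectionGroup hB {d₁, d₂} ≤ transvectionGroup hB Δ :=
    Subgroup.closure_mono (Set.image_mono (Set.pair_subset h₁ h₂))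
  have hmem : ∀ v ∈ Δ, τ hB v ∈ transvectionGroup hB Δ :=
    fun v hv => symplecticTransvection_mem_of_mem hB hv
  -- For `x ∈ Δ` not orthogonal to the pair, reduction by `T_{d₁}, T_{d₂}` keeps `π x` and reaches
  -- `a • d₁ + π x ∈ Δ` with `a ≠ 0`, so `(2 * a) • π x` is a translation. Such `x` span `V`. Only
  -- the Euclidean part of the reduction is needed, hence `M = ⊥`.
  obtain ⟨n, hn, hnJ⟩ := exists_smul_apply_mem π (translationLattice B d₁ d₂ Δ)
    (hΔ.span_not_orthogonal hd h₁) fun x hx => by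
      obtain ⟨k, hk, hk₀, hk₁, -⟩ := exists_reduced (M := ⊥) hB hd
        (symplecticTransvection_mem_of_mem hB (S := {d₁, d₂}) (by simp))
        (symplecticTransvection_mem_of_mem hB (S := {d₁, d₂}) (by simp)) (by simp) (by simp)
        (by simpa using symplecticTransvection_mem_of_mem hB (S := {d₁, d₂}) (v := d₂) (by simp))
        x (hx.2.imp_right Or.inl)
      refine ⟨2 * B (k x) d₂, mul_ne_zero two_ne_zero hk₀, ?_⟩
      refine smul_mem_translationLattice hB hd (transvectionGroup_le_isometryGroup hB Δ)
        (hmem d₁ h₁) (hmem d₂ h₂) hΔ.apply_mem ?_ ?_ ?_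
      · simp [hπ, hd, form_self hB]
      · simp [hπ, hd', form_self hB, form_swap hB x d₂]
      · rw [← hπk k hk, hπ, hk₁, zero_smul, sub_zero, add_sub_cancel]
        exact hmem _ (hΔ.apply_mem k (hle hk) x hx.1)
  refine ⟨n, hn, fun x hx₁ hx₂ => ?_⟩
  have := hnJ x
  rw [hπ, hx₁, form_swap hB x, hx₂, neg_zero, zero_smul, zero_smul, sub_zero, sub_zero] at this
  have h := ((mem_translationLattice.1 this).2.2 0 (map_zero _) (map_zero _)).1 (by simpa using h₁)
  simpa using h

/-- A hyperbolic pair, together with translates of multiples of independent vectors of its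
orthogonal complement, is linearly independent. -/
theorem linearIndependent_pair_sum {ι : Type*} [Fintype ι] [Module.Free ℤ V] (hB : B.IsAlt)
    (hd : B d₁ d₂ = 1) {b : ι → V} (hb : LinearIndependent ℤ b) (hb₁ : ∀ i, B d₁ (b i) = 0)
    (hb₂ : ∀ i, B d₂ (b i) = 0) {n : ℤ} (hn : n ≠ 0) :
    LinearIndependent ℤ (Sum.elim ![d₁, d₂] fun i => d₁ + n • b i) := by
  rw [Fintype.linearIndependent_iff]
  intro c hc
  rw [Fintype.sum_sum_type, Fin.sum_univ_two] at hc
  simp only [Sum.elim_inl, Sum.elim_inr, Matrix.cons_val_zero, Matrix.cons_val_one, smul_add,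
    Finset.sum_add_distrib, ← Finset.sum_smul] at hc
  have hd' : B d₂ d₁ = -1 := by rw [form_swap hB, hd]
  have e₁ := congrArg (B d₁) hc
  have e₂ := congrArg (B d₂) hc
  simp only [map_add, map_smul, map_sum, hb₁, hb₂, form_self hB, hd, hd', smul_eq_mul, mul_zero,
    Finset.sum_const_zero, map_zero] at e₁ e₂
  have hsum : ∑ i, (c (Sum.inr i) * n) • b i = 0 := by
    have h0 : c (Sum.inl 1) = 0 := by linarith
    have h1 : c (Sum.inl 0) = -∑ i, c (Sum.inr i) := by linarith
    rw [h0, h1] at hc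
    simpa [mul_smul] using hc
  have hr : ∀ i, c (Sum.inr i) = 0 := fun i =>
    (mul_eq_zero.1 (Fintype.linearIndependent_iff.1 hb _ hsum i)).resolve_right hn
  simp only [hr, Finset.sum_const_zero] at e₁ e₂
  rintro (i | i)
  · fin_cases i
    · change c (Sum.inl 0) = 0
      linarith
    · change c (Sum.inl 1) = 0
      linarith
  · exact hr i

end Existence

end VanishingLattice

/-! ### Choice of the elements and conclusion. -/

open VanishingLattice in
theorem mainTheorem4 {V : Type*} [AddCommGroup V] [Module.Free ℤ V]
    [Module.Finite ℤ V] (r : ℕ) (hr : Module.finrank ℤ V = r)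
    (B : LinearMap.BilinForm ℤ V) (hB : B.IsAlt)
    (Δ : Set V) (hΔ : VanishingLattice.IsVanishingLattice hB Δ) :
    ∃ δ : Fin r → V, (∀ i, δ i ∈ Δ) ∧ LinearIndependent ℤ δ ∧
      ((VanishingLattice.transvectionGroup hB (Set.range δ)).subgroupOf
        (VanishingLattice.transvectionGroup hB Δ)).FiniteIndex := by
  obtain ⟨d₁, h₁, d₂, h₂, hd⟩ := hΔ.exists_pair
  have hd' : B d₂ d₁ = -1 := by rw [form_swap hB, hd]
  obtain ⟨n, hn, hnΔ⟩ := hΔ.exists_add_smul_mem hd h₁ h₂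
  let φ : V →ₗ[ℤ] ℤ × ℤ := (B d₁).prod (B d₂)
  let K := LinearMap.ker φ
  have hK : ∀ x, x ∈ K ↔ B d₁ x = 0 ∧ B d₂ x = 0 := fun x => by
    rw [LinearMap.mem_ker]
    exact Prod.mk_eq_zero
  have hφ : LinearMap.range φ = ⊤ := by
    rw [LinearMap.range_eq_top]
    rintro ⟨a, b⟩
    refine ⟨a • d₂ - b • d₁, ?_⟩
    change (B d₁ _, B d₂ _) = _
    simp [form_self hB, hd, hd']
  have hrank : r = 2 + Module.finrank ℤ K := by
    rw [← hr, ← Submodule.finrank_quotient_add_finrank K, φ.quotKerEquivRange.finrank_eq, hφ,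
      finrank_top]
    simp
  let b := Module.finBasis ℤ K
  have hb : LinearIndependent ℤ fun i => (b i : V) :=
    b.linearIndependent.map' K.subtype K.ker_subtype
  have hb₁ : ∀ i, B d₁ (b i : V) = 0 := fun i => ((hK _).1 (b i).2).1
  have hb₂ : ∀ i, B d₂ (b i : V) = 0 := fun i => ((hK _).1 (b i).2).2
  have hm : 2 * n ≠ 0 := mul_ne_zero two_ne_zero hn
  -- The factor `n` puts `d₁ + s` in `Δ`; the factor `2` makes the form even on the span.
  let S : Set V := Set.range fun i => (2 * n) • (b i : V)
  have hSK : ∀ u ∈ Submodule.span ℤ S, ∃ x ∈ K, u = (2 : ℤ) • x := by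
    have : Submodule.span ℤ S ≤ K.map (LinearMap.lsmul ℤ V 2) := by
      refine Submodule.span_le.2 ?_
      rintro _ ⟨i, rfl⟩
      exact ⟨n • (b i : V), K.smul_mem n (b i).2, by simp [mul_smul, smul_comm n]⟩
    intro u hu
    obtain ⟨x, hx, rfl⟩ := this hu
    exact ⟨x, hx, rfl⟩
  have hcompl : IsEvenComplement B d₁ d₂ (Submodule.span ℤ S) (2 * n) :=
    { pair := hd
      left := fun u hu => by
        obtain ⟨x, hx, rfl⟩ := hSK u hu
        rw [map_smul, ((hK x).1 hx).1, smul_zero]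
      right := fun u hu => by
        obtain ⟨x, hx, rfl⟩ := hSK u hu
        rw [map_smul, ((hK x).1 hx).2, smul_zero]
      even := fun u hu w _ => by
        obtain ⟨x, -, rfl⟩ := hSK u hu
        exact ⟨B x w, by simp⟩
      ne_zero := hm
      smul_mem := fun x hx₁ hx₂ => by
        have hx := congrArg K.subtype (b.sum_repr ⟨x, (hK x).2 ⟨hx₁, hx₂⟩⟩)
        simp only [map_sum, map_smul, Submodule.subtype_apply] at hx
        rw [← hx, Finset.smul_sum]
        refine sum_mem fun i _ => ?_
        rw [smul_comm]
        exact Submodule.smul_mem _ _ (Submodule.subset_span ⟨i, rfl⟩) }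
  let δ : Fin 2 ⊕ Fin (Module.finrank ℤ K) → V :=
    Sum.elim ![d₁, d₂] fun i => d₁ + (2 * n) • (b i : V)
  have hδ₁ : d₁ ∈ Set.range δ := ⟨Sum.inl 0, rfl⟩
  have hδ₂ : d₂ ∈ Set.range δ := ⟨Sum.inl 1, rfl⟩
  have hδS : ∀ s ∈ S, d₁ + s ∈ Set.range δ := by
    rintro _ ⟨i, rfl⟩
    exact ⟨Sum.inr i, rfl⟩
  have hδ : ∀ i, δ i = d₁ ∨ δ i = d₂ ∨ ∃ x ∈ K, (2 * n) • x ∈ S ∧ δ i = d₁ + (2 * n) • x := by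
    rintro (i | i)
    · fin_cases i
      · exact Or.inl rfl
      · exact Or.inr (Or.inl rfl)
    · exact Or.inr (Or.inr ⟨b i, (b i).2, ⟨i, rfl⟩, rfl⟩)
  let e : Fin r ≃ Fin 2 ⊕ Fin (Module.finrank ℤ K) :=
    (finCongr hrank).trans finSumFinEquiv.symm
  refine ⟨δ ∘ e, fun i => ?_, ?_, ⟨?_⟩⟩
  · rw [Function.comp_apply]
    obtain h | h | ⟨x, hx, -, h⟩ := hδ (e i)
    · rwa [h]
    · rwa [h]
    · rw [h, mul_comm, mul_smul]
      have := (hK x).1 hx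
      exact hnΔ _ (by rw [map_smul, this.1, smul_zero]) (by rw [map_smul, this.2, smul_zero])
  · exact (linearIndependent_pair_sum hB hd hb hb₁ hb₂ hm).comp e e.injective
  · rw [e.surjective.range_comp]
    have hL₁ : d₁ ∈ pairSpan d₁ d₂ (Submodule.span ℤ S) := left_mem_pairSpan
    have hL₂ : d₂ ∈ pairSpan d₁ d₂ (Submodule.span ℤ S) := right_mem_pairSpan
    -- The intermediate group consists of the isometries preserving the lattice and fixing the
    -- radical; it need not lie in `Γ_Δ`, so relative indices are used.
    refine Subgroup.relIndex_ne_zero_trans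
      (transvectionGroup_relIndex_latticeGroup_ne_zero hB hcompl ?_ hδ₁ hδ₂ hδS)
      (latticeGroup_relIndex_ne_zero hB Δ hm fun x => ?_)
    · rintro _ ⟨i, rfl⟩
      obtain h | h | ⟨x, hx, hxS, h⟩ := hδ i
      · exact ⟨by rwa [h], d₂, hL₂, by rw [h, hd]⟩
      · exact ⟨by rwa [h], -d₁, neg_mem hL₁, by rw [h, map_neg, hd', neg_neg]⟩
      · rw [h]
        refine ⟨add_mem hL₁ (le_pairSpan (Submodule.subset_span hxS)), d₂, hL₂, ?_⟩
        have : B x d₂ = 0 := by rw [form_swap hB, ((hK x).1 hx).2, neg_zero]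
        simp [hd, this]
    · have hu := hcompl.smul_mem (x - B x d₂ • d₁ - B d₁ x • d₂) (by simp [form_self hB, hd])
        (by simp [form_self hB, hd', form_swap hB x d₂])
      refine mem_pairSpan.2 ⟨2 * n * B x d₂, 2 * n * B d₁ x, _, hu, ?_⟩
      module
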